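/- Let $0<p<1$. For a real window $T>0$ let $r(T)=(1-p)^T$ be its success rate, i.e. the probability that the graph is still connected after $T$ swaps when each swap disconnects a connected graph with constant probability $p$ and never reconnects a disconnected one. Let $\theta(T)=T\,r(T)$ be the speed-up factor, i.e. the expected number of swaps actually performed between two connectivity tests. A window is optimal if it maximizes $\theta$ over all $T>0$. For $q^+,q^->0$ and an initial window $T_0>0$, let $(T_t)_{t\ge 0}$ be the Markov process in which, given $T_0,\dots,T_t$, the next window is $T_{t+1}=T_t(1+q^+)$ with probability $r(T_t)$ and $T_{t+1}=T_t(1-q^-)$ with probability $1-r(T_t)$. For $c>0$, $\kappa\ge 0$ and $L>0$, say that the window converges to $L$ and stays close to it (for the ratio $c$ and the horizon $\kappa$) if for all $\varepsilon,\delta>0$ there is $q_0>0$ such that, for all $q^+,q^-\in(0,q_0)$ with $q^+/q^-=c$ and all $T_0>0$, there is $t_0$ such that for every $t\ge t_0$ $$\mathbb P\bigl(|T_s-L|<\varepsilon\ \text{ for all integers } s \text{ with } t\le s\le t+\kappa/q^-\bigr)\ \ge\ 1-\delta .$$ Then: (a) For all $q^+,q^->0$ there is exactly one mean window, i.e. one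 $T>0$ with $T=r(T)\,(1+q^+)\,T+(1-r(T))\,(1-q^-)\,T$, and a window $T>0$ is the mean window if and only if $r(T)=\dfrac{q^-}{q^++q^-}$. (b) For every $c>0$ the mean window is the same for all $q^+,q^->0$ with $q^+/q^-=c$, and for every $\kappa\ge 0$ the window converges to it and stays close to it. (c) There is exactly one optimal window, and for every $c>0$ and every $\kappa\ge0$ the window converges to the optimal window and stays close to it if and only if $c=e-1$, i.e. $q^+/q^-=e-1$. -/

import Mathlib

open MeasureTheory Set

noncomputable section

namespace SpeedUp

/-- The success rate `r(T) = (1 - p) ^ T` of a window `T`, for a disconnection probability `p` that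
is constant and a reconnection probability equal to zero. As in the window dynamics, `T` ranges
over the positive reals. -/
def successRate (p T : ℝ) : ℝ := (1 - p) ^ T

/-- The probability that the graph is connected after `n` swaps, by the law of total probability:
a connected graph is disconnected by a swap with probability `p`, and a disconnected one is
reconnected with probability `0`. -/
def connectedAfter (p : ℝ) : ℕ → ℝ
  | 0 => 1
  | n + 1 => connectedAfter p n * (1 - p) + (1 - connectedAfter p n) * 0

theorem connectedAfter_eq_successRate (p : ℝ) (n : ℕ) :
    connectedAfter p n = successRate p n := by
  rw [successRate, Real.rpow_natCast]
  induction n with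
  | zero => simp [connectedAfter]
  | succ n ih => simp [connectedAfter, ih, pow_succ]

/-- The speed-up factor: the expected number of swaps actually performed between two connectivity
tests, which is `T` with probability `r(T)` and `0` otherwise. -/
def speedUpFactor (p T : ℝ) : ℝ := successRate p T * T + (1 - successRate p T) * 0

/-- `T` is an optimal window: it maximizes the speed-up factor over all positive windows. -/
def IsOptimalWindow (p T : ℝ) : Prop :=
  0 < T ∧ IsMaxOn (speedUpFactor p) (Ioi 0) T

/-- The law of the randomness that drives the dynamics: independent uniform variables
`U 0, U 1, …` on `[0, 1]`. -/
def noise : Measure (ℕ → unitInterval) :=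
  Measure.infinitePi fun _ : ℕ => (volume : Measure unitInterval)

instance : IsProbabilityMeasure noise := by
  unfold noise
  infer_instance

open Classical in
/-- The window at step `n`, started at `T₀`. At each step the graph stays connected after `T` swaps
with probability `r(T)`, given the past; then `T ← T (1 + q⁺)`, and otherwise `T ← T (1 - q⁻)`. -/
def window (p qp qm T₀ : ℝ) (U : ℕ → unitInterval) : ℕ → ℝ
  | 0 => T₀
  | n + 1 =>
    if (U n : ℝ) < successRate p (window p qp qm T₀ U n) then
      window p qp qm T₀ U n * (1 + qp)
    else
      window p qp qm T₀ U n * (1 - qm)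

/-- The expectation of the next window, given that the present one is `T`. -/
def expectedNext (p qp qm T : ℝ) : ℝ :=
  successRate p T * (T * (1 + qp)) + (1 - successRate p T) * (T * (1 - qm))

/-- `T` is a mean window of the dynamics: a positive window whose expected update is itself. -/
def IsMeanWindow (p qp qm T : ℝ) : Prop :=
  0 < T ∧ T = expectedNext p qp qm T

/-- For `q⁺, q⁻` close enough to `0` with `q⁺ / q⁻ = c`, the window converges to `L` and stays
arbitrarily close to it with arbitrarily high probability: whatever the precision `ε` and the
failure probability `δ`, if `q⁺, q⁻` are small enough then from any initial window there is a step
`t₀` such that, for every later step `t`, with probability at least `1 - δ` the window is within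
`ε` of `L` at all the steps from `t` to `t + κ / q⁻`.

For `κ = 0` this concerns each single late step. Larger `κ` reach over times in which the window
is able to change by arbitrarily large factors. -/
def ConvergesAndStaysNear (p c κ L : ℝ) : Prop :=
  ∀ ε > 0, ∀ δ > 0, ∃ q₀ > 0, ∀ qp qm : ℝ, 0 < qp → qp < q₀ → 0 < qm → qm < q₀ → qp / qm = c →
    ∀ T₀ > 0, ∃ t₀ : ℕ, ∀ t ≥ t₀,
      1 - δ ≤ noise.real {U | ∀ s : ℕ, t ≤ s → (s : ℝ) ≤ t + κ / qm →
        |window p qp qm T₀ U s - L| < ε}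

end SpeedUp

end

namespace SpeedUp

/-! With `a = -log (1 - p)` the success rate is `exp (-a T)`. The mean window for the ratio `c`
solves `exp (-a T) = 1 / (c + 1)`, and `T exp (-a T)` is maximal only at `1 / a`, where the success
rate is `1 / e`. The two windows agree exactly when `c + 1 = e`.

Concentration at the mean window `L` comes from `V(T) = T/L + L/T - 2`, which suits multiplicative
updates because it is unchanged by `T/L ↦ L/T`. One step multiplies the expectation of `V` by at
most `1 - m q⁻ / 2` and adds `O((q⁻)²)` (`expected_lyapunov_le`). Iterating, the expectation becomes
`O(q⁻)` whatever the initial window (`lintegral_window_le`). A maximal inequality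
(`mul_noise_compl_staysBelow_le`) covers the next `κ / q⁻` steps, whose errors add up to `O(κ q⁻)`
only.

Limits are unique, and `ratioWindow` is injective in `c`, so convergence to the optimal window
forces `c = e - 1`. -/

/-! ### Success rate, mean window and optimal window. -/

theorem neg_log_one_sub_pos {p : ℝ} (hp₀ : 0 < p) (hp₁ : p < 1) : 0 < -Real.log (1 - p) :=
  neg_pos.2 (Real.log_neg (by linarith) (by linarith))

theorem successRate_eq_exp {p : ℝ} (hp₁ : p < 1) (T : ℝ) :
    successRate p T = Real.exp (-(-Real.log (1 - p) * T)) := by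
  rw [successRate, Real.rpow_def_of_pos (by linarith)]
  congr 1
  ring

theorem successRate_pos {p : ℝ} (hp₁ : p < 1) (T : ℝ) : 0 < successRate p T := by
  rw [successRate_eq_exp hp₁]
  exact Real.exp_pos _

theorem successRate_le_one {p T : ℝ} (hp₀ : 0 < p) (hp₁ : p < 1) (hT : 0 ≤ T) :
    successRate p T ≤ 1 :=
  Real.rpow_le_one (by linarith) (by linarith) hT

theorem measurable_successRate (p : ℝ) : Measurable (successRate p) := by
  unfold successRate
  fun_prop

theorem isMeanWindow_iff {p qp qm T : ℝ} (hqp : 0 < qp) (hqm : 0 < qm) (hT : 0 < T) :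
    IsMeanWindow p qp qm T ↔ successRate p T = qm / (qp + qm) := by
  have hs : 0 < qp + qm := by positivity
  rw [eq_div_iff hs.ne']
  constructor
  · rintro ⟨-, h⟩
    rw [expectedNext] at h
    refine mul_left_cancel₀ hT.ne' ?_
    linear_combination -h
  · intro h
    refine ⟨hT, ?_⟩
    rw [expectedNext]
    linear_combination -T * h

/-- The window whose success rate is `1 / (c + 1)`. -/
noncomputable def ratioWindow (p c : ℝ) : ℝ := Real.log (c + 1) / -Real.log (1 - p)

theorem ratioWindow_pos {p c : ℝ} (hp₀ : 0 < p) (hp₁ : p < 1) (hc : 0 < c) :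
    0 < ratioWindow p c :=
  div_pos (Real.log_pos (by linarith)) (neg_log_one_sub_pos hp₀ hp₁)

theorem successRate_eq_inv_iff {p c T : ℝ} (hp₀ : 0 < p) (hp₁ : p < 1) (hc : 0 < c) :
    successRate p T = 1 / (c + 1) ↔ T = ratioWindow p c := by
  have ha := neg_log_one_sub_pos hp₀ hp₁
  rw [successRate_eq_exp hp₁, ratioWindow, eq_div_iff ha.ne', Real.exp_neg, one_div, inv_inj,
    ← Real.exp_log (show 0 < c + 1 by linarith), Real.exp_injective.eq_iff, Real.log_exp,
    mul_comm]

theorem isMeanWindow_iff_eq {p qp qm c T : ℝ} (hp₀ : 0 < p) (hp₁ : p < 1) (hqp : 0 < qp)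
    (hqm : 0 < qm) (hc : qp / qm = c) : IsMeanWindow p qp qm T ↔ T = ratioWindow p c := by
  have hc₀ : 0 < c := hc ▸ div_pos hqp hqm
  have hr : qm / (qp + qm) = 1 / (c + 1) := by
    rw [← hc]
    field_simp
  constructor
  · intro h
    rwa [isMeanWindow_iff hqp hqm h.1, hr, successRate_eq_inv_iff hp₀ hp₁ hc₀] at h
  · intro h
    rwa [isMeanWindow_iff hqp hqm (h ▸ ratioWindow_pos hp₀ hp₁ hc₀), hr,
      successRate_eq_inv_iff hp₀ hp₁ hc₀]

theorem isOptimalWindow_iff {p T : ℝ} (hp₀ : 0 < p) (hp₁ : p < 1) :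
    IsOptimalWindow p T ↔ T = ratioWindow p (Real.exp 1 - 1) := by
  have ha := neg_log_one_sub_pos hp₀ hp₁
  have hL : ratioWindow p (Real.exp 1 - 1) = 1 / -Real.log (1 - p) := by
    simp [ratioWindow]
  have hθ (S : ℝ) : speedUpFactor p S = Real.exp (-(-Real.log (1 - p) * S)) * S := by
    rw [speedUpFactor, successRate_eq_exp hp₁, mul_zero, add_zero]
  rw [hL]
  generalize -Real.log (1 - p) = a at *
  -- This is `a S ≤ exp (a S - 1)`, strict unless `a S = 1`, multiplied by `exp (-a S)`.
  have hmax (S : ℝ) : speedUpFactor p S ≤ Real.exp (-1) / a ∧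
      (S ≠ 1 / a → speedUpFactor p S < Real.exp (-1) / a) := by
    have key : Real.exp (-(a * S)) * Real.exp (a * S - 1) = Real.exp (-1) := by
      rw [← Real.exp_add]
      congr 1
      ring
    rw [hθ, le_div_iff₀ ha, lt_div_iff₀ ha, ← key, mul_assoc]
    constructor
    · gcongr
      linarith [Real.add_one_le_exp (a * S - 1)]
    · intro hS
      gcongr
      have : a * S - 1 ≠ 0 := fun h => hS (by field_simp; linarith)
      linarith [Real.add_one_lt_exp this]
  have hval : speedUpFactor p (1 / a) = Real.exp (-1) / a := by
    rw [hθ, mul_one_div_cancel ha.ne']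
    ring
  constructor
  · rintro ⟨-, h⟩
    by_contra hne
    have h₁ := h (show (1 / a) ∈ Ioi (0 : ℝ) from one_div_pos.2 ha)
    have h₂ := (hmax T).2 hne
    simp only [mem_ofPred_eq, hval] at h₁
    linarith
  · rintro rfl
    refine ⟨one_div_pos.2 ha, fun S _ => ?_⟩
    simp only [mem_ofPred_eq, hval]
    exact (hmax S).1

/-! ### The Lyapunov function and its drift. -/

/-- A Lyapunov function of the window dynamics, which measures the distance of `T` to `L`. -/
noncomputable def lyapunov (L T : ℝ) : ℝ := T / L + L / T - 2

theorem measurable_lyapunov (L : ℝ) : Measurable (lyapunov L) := by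
  unfold lyapunov
  fun_prop

theorem lyapunov_eq {L T : ℝ} (hL : 0 < L) (hT : 0 < T) :
    lyapunov L T = (T - L) ^ 2 / (T * L) := by
  rw [lyapunov]
  field_simp
  ring

theorem lyapunov_nonneg {L T : ℝ} (hL : 0 < L) (hT : 0 < T) : 0 ≤ lyapunov L T := by
  rw [lyapunov_eq hL hT]
  positivity

/-- The threshold is the value of `lyapunov L` at `L + ε`. Below `L` the function grows faster, so
the same threshold serves both sides. -/
theorem abs_sub_lt_of_lyapunov_lt {L T ε : ℝ} (hL : 0 < L) (hT : 0 < T) (hε : 0 < ε)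
    (h : lyapunov L T < ε ^ 2 / (L * (L + ε))) : |T - L| < ε := by
  by_contra! hge
  rw [lyapunov_eq hL hT, div_lt_div_iff₀ (by positivity) (by positivity)] at h
  have h₁ : (T - L) ^ 2 * (L + ε) < ε ^ 2 * T := by
    refine lt_of_mul_lt_mul_right ?_ hL.le
    linarith
  have h₂ : ε ^ 2 ≤ (T - L) ^ 2 := by
    rw [← sq_abs (T - L)]
    gcongr
  rcases le_abs'.1 hge with h₃ | h₃
  · nlinarith [mul_le_mul_of_nonneg_right h₂ (show 0 ≤ L + ε by linarith), sq_nonneg ε]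
  · nlinarith [mul_le_mul_of_nonneg_left h₃ (show 0 ≤ (T - L) * L by nlinarith),
      mul_le_mul_of_nonneg_left h₃ (show 0 ≤ (T - L) * ε by nlinarith),
      mul_le_mul_of_nonneg_left h₃ (show 0 ≤ L * ε by nlinarith), mul_pos hε hε]

/-- With `x = T / L` and `b = log (c + 1)`, the left side is the first-order coefficient in `q` of
the expected change of `lyapunov`. Both factors change sign at `x = 1`, in opposite directions. The
bound `1` in the minimum is needed for large `x`, where the left side behaves like `-x`. -/
theorem drift_le {b x : ℝ} (hb : 0 < b) (hx : 0 < x) :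
    (x - 1 / x) * (Real.exp (-(b * (x - 1))) - 1) ≤ -min 1 b * (x + 1 / x - 2) := by
  have h₁ : x - 1 / x = (x + 1) * (x - 1) / x := by
    field_simp
    ring
  have h₂ : x + 1 / x - 2 = (x - 1) ^ 2 / x := by
    field_simp
    ring
  rw [h₁, h₂, div_mul_eq_mul_div, ← mul_div_assoc]
  gcongr ?_ / x
  have hm₁ := min_le_left 1 b
  have hm₂ := min_le_right 1 b
  have hm : 0 < min 1 b := lt_min one_pos hb
  generalize min 1 b = m at *
  rcases le_total 1 x with h | h
  · suffices m * (x - 1) ≤ (x + 1) * (1 - Real.exp (-(b * (x - 1)))) by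
      nlinarith [mul_le_mul_of_nonneg_left this (sub_nonneg.2 h)]
    have hy : 0 ≤ b * (x - 1) := mul_nonneg hb.le (by linarith)
    -- For `x ≥ 1` the tangent bound on `exp (-y)` is useless at large `y`; inverting `1 + y ≤ exp
    -- y` keeps a bound that saturates.
    have hE : Real.exp (-(b * (x - 1))) ≤ 1 / (1 + b * (x - 1)) := by
      rw [Real.exp_neg, ← one_div]
      gcongr
      linarith [Real.add_one_le_exp (b * (x - 1))]
    have hq : 1 - 1 / (1 + b * (x - 1)) = b * (x - 1) / (1 + b * (x - 1)) := by
      field_simp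
      ring
    calc m * (x - 1) ≤ (x + 1) * (b * (x - 1) / (1 + b * (x - 1))) := by
          rw [← mul_div_assoc, le_div_iff₀ (by positivity)]
          have : m * (1 + b * (x - 1)) ≤ (x + 1) * b := by nlinarith
          nlinarith [mul_le_mul_of_nonneg_left this (sub_nonneg.2 h)]
      _ ≤ _ := by
          gcongr
          linarith
  · have hE := Real.add_one_le_exp (-(b * (x - 1)))
    have h₃ : m * (1 - x) ≤ (x + 1) * (Real.exp (-(b * (x - 1))) - 1) := by
      calc m * (1 - x) ≤ 1 * (b * (1 - x)) := by nlinarith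
        _ ≤ _ := by
          gcongr
          · nlinarith
          · linarith
    nlinarith [mul_le_mul_of_nonneg_left h₃ (sub_nonneg.2 h)]

/-- The Lyapunov function decreases in expectation, up to an error of second order. -/
theorem expected_lyapunov_le {p c q T : ℝ} (hp₀ : 0 < p) (hp₁ : p < 1) (hc : 0 < c) (hq : 0 < q)
    (hq₁ : q ≤ 1 / 2) (hq₂ : 2 * (c ^ 2 + 2) * q ≤ min 1 (Real.log (c + 1))) (hT : 0 < T) :
    successRate p T * lyapunov (ratioWindow p c) (T * (1 + c * q)) +
      (1 - successRate p T) * lyapunov (ratioWindow p c) (T * (1 - q)) ≤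
    (1 - min 1 (Real.log (c + 1)) / 2 * q) * lyapunov (ratioWindow p c) T +
      2 * (c ^ 2 + 2) * q ^ 2 := by
  have hb : 0 < Real.log (c + 1) := Real.log_pos (by linarith)
  have hL := ratioWindow_pos hp₀ hp₁ hc
  have ha := neg_log_one_sub_pos hp₀ hp₁
  have hr₀ := successRate_pos hp₁ T
  have hr₁ := successRate_le_one hp₀ hp₁ hT.le
  have hr : (c + 1) * successRate p T =
      Real.exp (-(Real.log (c + 1) * (T / ratioWindow p c - 1))) := by
    rw [successRate_eq_exp hp₁]
    nth_rw 1 [← Real.exp_log (show 0 < c + 1 by linarith)]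
    rw [← Real.exp_add, ratioWindow]
    congr 1
    field_simp
    ring
  have hdrift := drift_le hb (div_pos hT hL)
  rw [← hr] at hdrift
  have hx : 0 < T / ratioWindow p c := div_pos hT hL
  have hV := lyapunov_nonneg hL hT
  have e₀ (k : ℝ) : lyapunov (ratioWindow p c) (T * k) =
      T / ratioWindow p c * k + 1 / (T / ratioWindow p c) * (1 / k) - 2 := by
    rw [lyapunov]
    field_simp
  have e₁ : lyapunov (ratioWindow p c) T =
      T / ratioWindow p c + 1 / (T / ratioWindow p c) - 2 := by
    simpa using e₀ 1
  rw [e₁] at hV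
  rw [e₀, e₀, e₁]
  generalize T / ratioWindow p c = x at *
  generalize successRate p T = r at *
  generalize min 1 (Real.log (c + 1)) = m at *
  have hcq : 0 < c * q := mul_pos hc hq
  have i₁ : 1 / (1 + c * q) ≤ 1 - c * q + c ^ 2 * q ^ 2 := by
    rw [div_le_iff₀ (by positivity)]
    nlinarith [pow_pos hcq 3]
  have i₂ : 1 / (1 - q) ≤ 1 + q + 2 * q ^ 2 := by
    rw [div_le_iff₀ (by linarith)]
    nlinarith [mul_nonneg (sq_nonneg q) (show 0 ≤ 1 - 2 * q by linarith)]
  have hy : 0 < 1 / x := one_div_pos.2 hx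
  generalize 1 / x = y at *
  have i₃ : r * (1 / (1 + c * q)) + (1 - r) * (1 / (1 - q)) ≤
      1 - q * ((c + 1) * r - 1) + (c ^ 2 + 2) * q ^ 2 := by
    have j₁ := mul_le_mul_of_nonneg_left i₁ hr₀.le
    have j₂ := mul_le_mul_of_nonneg_left i₂ (sub_nonneg.2 hr₁)
    have j₃ : 0 ≤ (1 - r) * (c ^ 2 * q ^ 2) + r * (2 * q ^ 2) :=
      add_nonneg (mul_nonneg (by linarith) (by positivity)) (by positivity)
    nlinarith
  have i₄ := mul_le_mul_of_nonneg_left i₃ hy.le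
  have i₅ := mul_le_mul_of_nonneg_left hdrift hq.le
  -- The second-order error is at most `(c² + 2) q² (x + y)`, and `x + y = V + 2`: half of the drift
  -- absorbs the `V` part, leaving the constant `2 (c² + 2) q²`.
  have i₆ := mul_le_mul_of_nonneg_right hq₂ (mul_nonneg hV hq.le)
  have i₇ : 0 ≤ (c ^ 2 + 2) * q ^ 2 * x := by positivity
  nlinarith

/-! ### Resampling one noise variable. -/

open scoped ENNReal

theorem measurable_update_prod (n : ℕ) :
    Measurable fun x : (ℕ → unitInterval) × unitInterval => Function.update x.1 n x.2 := by
  refine measurable_pi_lambda _ fun i => ?_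
  by_cases h : i = n
  · subst h
    simpa using measurable_snd
  · simp only [Function.update_of_ne h]
    exact (measurable_pi_apply i).comp measurable_fst

/-- The infinite product is determined by its values on finite boxes, and on a box the new
coordinate `n` supplies the factor that the old one would have given. -/
theorem map_update_noise (n : ℕ) :
    (noise.prod (volume : Measure unitInterval)).map (fun x => Function.update x.1 n x.2) =
      noise := by
  classical
  refine Measure.eq_infinitePi _ fun s t ht => ?_
  have hm := measurable_update_prod n
  rw [Measure.map_apply hm (.pi s.countable_toSet fun i _ => ht i)]
  by_cases hn : n ∈ s
  · have : (fun x : (ℕ → unitInterval) × unitInterval => Function.update x.1 n x.2) ⁻¹'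
        (s : Set ℕ).pi t = ((s.erase n : Finset ℕ) : Set ℕ).pi t ×ˢ t n := by
      ext x
      simp only [mem_preimage, mem_pi, mem_prod, Finset.mem_coe, Finset.mem_erase]
      constructor
      · intro h
        refine ⟨fun i hi => ?_, ?_⟩
        · simpa [Function.update_of_ne hi.1] using h i hi.2
        · simpa using h n hn
      · rintro ⟨h₁, h₂⟩ i hi
        by_cases h : i = n
        · subst h
          simpa using h₂
        · simpa [Function.update_of_ne h] using h₁ i ⟨h, hi⟩
    rw [this, Measure.prod_prod, noise, Measure.infinitePi_pi _ fun i _ => ht i,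
      Finset.prod_erase_mul s _ hn]
  · have : (fun x : (ℕ → unitInterval) × unitInterval => Function.update x.1 n x.2) ⁻¹'
        (s : Set ℕ).pi t = (s : Set ℕ).pi t ×ˢ univ := by
      ext x
      simp only [mem_preimage, mem_pi, mem_prod, Finset.mem_coe, mem_univ, and_true]
      refine forall₂_congr fun i hi => ?_
      rw [Function.update_of_ne (ne_of_mem_of_not_mem hi hn)]
    rw [this, Measure.prod_prod, noise, Measure.infinitePi_pi _ fun i _ => ht i, measure_univ,
      mul_one]

/-- Resampling one of the variables does not change an expectation. -/
theorem lintegral_noise_update (n : ℕ) {f : (ℕ → unitInterval) → ℝ≥0∞} (hf : Measurable f) :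
    ∫⁻ U, f U ∂noise = ∫⁻ U, (∫⁻ u, f (Function.update U n u)) ∂noise := by
  have hm := measurable_update_prod n
  nth_rw 1 [← map_update_noise n]
  rw [lintegral_map hf hm]
  exact lintegral_prod _ (hf.comp hm).aemeasurable

theorem lintegral_unitInterval_ite {r : ℝ} (hr₀ : 0 ≤ r) (hr₁ : r ≤ 1) (a b : ℝ≥0∞) :
    ∫⁻ u : unitInterval, (open Classical in if (u : ℝ) < r then a else b) =
      ENNReal.ofReal r * a + ENNReal.ofReal (1 - r) * b := by
  classical
  have hI : MeasurableSet (Iio (⟨r, hr₀, hr₁⟩ : unitInterval)) := measurableSet_Iio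
  have : (fun u : unitInterval => (if (u : ℝ) < r then a else b)) =
      (Iio (⟨r, hr₀, hr₁⟩ : unitInterval)).piecewise (fun _ => a) (fun _ => b) := by
    ext u
    simp only [piecewise, mem_Iio, ← Subtype.coe_lt_coe]
  have h₂ := congrArg (fun f : unitInterval → ℝ≥0∞ => ∫⁻ u, f u) this
  calc _ = _ := by convert h₂
    _ = _ := by
      rw [lintegral_piecewise hI, compl_Iio]
      simp [mul_comm]

/-! ### Drift in expectation and a maximal inequality. -/

section Dynamics

variable {p qp qm T₀ : ℝ}

theorem window_pos (hqp : 0 < qp) (hqm : qm < 1) (hT₀ : 0 < T₀) (U : ℕ → unitInterval) (n : ℕ) :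
    0 < window p qp qm T₀ U n := by
  induction n with
  | zero => exact hT₀
  | succ n ih =>
    rw [window]
    split_ifs
    · exact mul_pos ih (by linarith)
    · exact mul_pos ih (by linarith)

theorem measurable_window (p qp qm T₀ : ℝ) (n : ℕ) :
    Measurable fun U => window p qp qm T₀ U n := by
  induction n with
  | zero => exact measurable_const
  | succ n ih =>
    simp only [window]
    refine Measurable.ite (measurableSet_lt ?_ ?_) (ih.mul_const _) (ih.mul_const _)
    · exact measurable_subtype_coe.comp (measurable_pi_apply n)
    · exact (measurable_successRate p).comp ih

theorem window_update {n k : ℕ} (h : n ≤ k) (U : ℕ → unitInterval) (u : unitInterval) :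
    window p qp qm T₀ (Function.update U k u) n = window p qp qm T₀ U n := by
  induction n with
  | zero => rfl
  | succ n ih => simp only [window, ih (by omega), Function.update_of_ne (show n ≠ k by omega)]

/-- The drift of a function of the window, on an event which is determined by the past. -/
theorem setLIntegral_window_succ_le (hp₀ : 0 < p) (hp₁ : p < 1) (hqp : 0 < qp) (hqm : qm < 1)
    (hT₀ : 0 < T₀) {V : ℝ → ℝ} (hV : Measurable V) (hV₀ : ∀ T > 0, 0 ≤ V T) {ρ K : ℝ}
    (hρ : 0 ≤ ρ) (hK : 0 ≤ K)
    (hdrift : ∀ T > 0, successRate p T * V (T * (1 + qp)) +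
      (1 - successRate p T) * V (T * (1 - qm)) ≤ ρ * V T + K)
    {n : ℕ} {A : Set (ℕ → unitInterval)} (hA : MeasurableSet A)
    (hAn : ∀ U u, Function.update U n u ∈ A ↔ U ∈ A) :
    ∫⁻ U in A, ENNReal.ofReal (V (window p qp qm T₀ U (n + 1))) ∂noise ≤
      ENNReal.ofReal ρ * ∫⁻ U in A, ENNReal.ofReal (V (window p qp qm T₀ U n)) ∂noise +
        ENNReal.ofReal K := by
  classical
  have hm (k : ℕ) : Measurable fun U => ENNReal.ofReal (V (window p qp qm T₀ U k)) :=
    (hV.comp (measurable_window p qp qm T₀ k)).ennreal_ofReal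
  calc ∫⁻ U in A, ENNReal.ofReal (V (window p qp qm T₀ U (n + 1))) ∂noise
      = ∫⁻ U, A.indicator (fun U => ENNReal.ofReal (V (window p qp qm T₀ U (n + 1)))) U
          ∂noise := (lintegral_indicator hA _).symm
    _ = ∫⁻ U, (∫⁻ u, A.indicator (fun U => ENNReal.ofReal (V (window p qp qm T₀ U (n + 1))))
          (Function.update U n u)) ∂noise :=
        lintegral_noise_update n ((hm (n + 1)).indicator hA)
    _ ≤ ∫⁻ U, A.indicator (fun U => ENNReal.ofReal ρ *
          ENNReal.ofReal (V (window p qp qm T₀ U n)) + ENNReal.ofReal K) U ∂noise := by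
        refine lintegral_mono fun U => ?_
        by_cases hU : U ∈ A
        · have hT : 0 < window p qp qm T₀ U n := window_pos hqp hqm hT₀ U n
          -- The window at step `n` uses only earlier variables, so `U n` is still free: integrating
          -- over it plays the role of conditioning on the past.
          have e (u : unitInterval) :
              A.indicator (fun U => ENNReal.ofReal (V (window p qp qm T₀ U (n + 1))))
                (Function.update U n u) =
              if (u : ℝ) < successRate p (window p qp qm T₀ U n) then
                ENNReal.ofReal (V (window p qp qm T₀ U n * (1 + qp)))
              else ENNReal.ofReal (V (window p qp qm T₀ U n * (1 - qm))) := by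
            rw [indicator_of_mem ((hAn U u).2 hU), window, window_update le_rfl,
              Function.update_self]
            split_ifs <;> rfl
          simp only [e, indicator_of_mem hU]
          have h₀ := hV₀ _ (mul_pos hT (show 0 < 1 + qp by linarith))
          have h₁ := hV₀ _ (mul_pos hT (show 0 < 1 - qm by linarith))
          have hr₀ := (successRate_pos hp₁ (window p qp qm T₀ U n)).le
          have hr₁ := successRate_le_one hp₀ hp₁ hT.le
          refine (le_of_eq (lintegral_unitInterval_ite hr₀ hr₁ _ _)).trans ?_
          rw [← ENNReal.ofReal_mul hr₀, ← ENNReal.ofReal_mul (sub_nonneg.2 hr₁),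
            ← ENNReal.ofReal_add (mul_nonneg hr₀ h₀) (mul_nonneg (sub_nonneg.2 hr₁) h₁),
            ← ENNReal.ofReal_mul hρ, ← ENNReal.ofReal_add (mul_nonneg hρ (hV₀ _ hT)) hK]
          exact ENNReal.ofReal_le_ofReal (hdrift _ hT)
        · simp [indicator_of_notMem hU, indicator_of_notMem ((hAn U _).not.2 hU)]
    _ = ∫⁻ U in A, (ENNReal.ofReal ρ * ENNReal.ofReal (V (window p qp qm T₀ U n)) +
          ENNReal.ofReal K) ∂noise := lintegral_indicator hA _
    _ = ENNReal.ofReal ρ * ∫⁻ U in A, ENNReal.ofReal (V (window p qp qm T₀ U n)) ∂noise +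
          ENNReal.ofReal K * noise A := by
        rw [lintegral_add_right _ measurable_const, lintegral_const_mul _ (hm n),
          setLIntegral_const]
    _ ≤ _ := by
        gcongr
        exact mul_le_of_le_one_right' prob_le_one

/-- Geometric decay of the expectation of a function with negative drift. -/
theorem lintegral_window_le (hp₀ : 0 < p) (hp₁ : p < 1) (hqp : 0 < qp) (hqm : qm < 1)
    (hT₀ : 0 < T₀) {V : ℝ → ℝ} (hV : Measurable V) (hV₀ : ∀ T > 0, 0 ≤ V T) {ρ K : ℝ}
    (hρ : 0 ≤ ρ) (hρ₁ : ρ < 1) (hK : 0 ≤ K)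
    (hdrift : ∀ T > 0, successRate p T * V (T * (1 + qp)) +
      (1 - successRate p T) * V (T * (1 - qm)) ≤ ρ * V T + K) (n : ℕ) :
    ∫⁻ U, ENNReal.ofReal (V (window p qp qm T₀ U n)) ∂noise ≤
      ENNReal.ofReal (ρ ^ n * V T₀ + K / (1 - ρ)) := by
  have hK' : 0 ≤ K / (1 - ρ) := div_nonneg hK (by linarith)
  have hV' := hV₀ _ hT₀
  induction n with
  | zero =>
    simp only [window, lintegral_const, measure_univ, mul_one, pow_zero, one_mul]
    exact ENNReal.ofReal_le_ofReal (by linarith)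
  | succ n ih =>
    have h := setLIntegral_window_succ_le hp₀ hp₁ hqp hqm hT₀ hV hV₀ hρ hK hdrift (n := n)
      MeasurableSet.univ (by simp)
    simp only [Measure.restrict_univ] at h
    refine h.trans ((add_le_add_left (mul_le_mul_right ih _) _).trans ?_)
    rw [← ENNReal.ofReal_mul hρ, ← ENNReal.ofReal_add (by positivity) hK]
    refine ENNReal.ofReal_le_ofReal (le_of_eq ?_)
    have : 1 - ρ ≠ 0 := by linarith
    field_simp
    ring

/-- The event that `V` remains below `v` during `n` steps from step `t` on. -/
def staysBelow (p qp qm T₀ : ℝ) (V : ℝ → ℝ) (v : ℝ) (t n : ℕ) : Set (ℕ → unitInterval) :=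
  {U | ∀ j < n, V (window p qp qm T₀ U (t + j)) < v}

theorem staysBelow_succ (V : ℝ → ℝ) (v : ℝ) (t n : ℕ) :
    staysBelow p qp qm T₀ V v t (n + 1) =
      staysBelow p qp qm T₀ V v t n \ {U | v ≤ V (window p qp qm T₀ U (t + n))} := by
  ext U
  simp only [staysBelow, mem_sdiff, mem_ofPred_eq, not_le, Nat.forall_lt_succ_right]

theorem measurableSet_staysBelow {V : ℝ → ℝ} (hV : Measurable V) (v : ℝ) (t n : ℕ) :
    MeasurableSet (staysBelow p qp qm T₀ V v t n) := by
  induction n with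
  | zero => simp [staysBelow]
  | succ n ih =>
    rw [staysBelow_succ]
    exact ih.diff (measurableSet_le measurable_const
      (hV.comp (measurable_window p qp qm T₀ (t + n))))

/-- Markov's inequality on the part of `A` where `f` reaches `v`: the mass moved into the complement
costs no more than the integral it gives up. -/
theorem mul_measure_compl_diff_add_le {Ω : Type*} [MeasurableSpace Ω] {μ : Measure Ω}
    {f : Ω → ℝ} (hf : Measurable f) (v : ℝ) (A : Set Ω) :
    ENNReal.ofReal v * μ (A \ {ω | v ≤ f ω})ᶜ +
      ∫⁻ ω in A \ {ω | v ≤ f ω}, ENNReal.ofReal (f ω) ∂μ ≤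
    ENNReal.ofReal v * μ Aᶜ + ∫⁻ ω in A, ENNReal.ofReal (f ω) ∂μ := by
  have hB : MeasurableSet {ω | v ≤ f ω} := measurableSet_le measurable_const hf
  have h₁ : (A \ {ω | v ≤ f ω})ᶜ ⊆ Aᶜ ∪ A ∩ {ω | v ≤ f ω} := by
    intro ω hω
    by_cases h : ω ∈ A
    · exact Or.inr ⟨h, by simpa [h] using hω⟩
    · exact Or.inl h
  have h₂ : ENNReal.ofReal v * μ (A ∩ {ω | v ≤ f ω}) ≤
      ∫⁻ ω in A ∩ {ω | v ≤ f ω}, ENNReal.ofReal (f ω) ∂μ := by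
    rw [← setLIntegral_const]
    exact setLIntegral_mono hf.ennreal_ofReal fun ω hω => ENNReal.ofReal_le_ofReal hω.2
  calc _ ≤ ENNReal.ofReal v * (μ Aᶜ + μ (A ∩ {ω | v ≤ f ω})) +
        ∫⁻ ω in A \ {ω | v ≤ f ω}, ENNReal.ofReal (f ω) ∂μ := by
        gcongr
        exact (measure_mono h₁).trans (measure_union_le _ _)
    _ ≤ ENNReal.ofReal v * μ Aᶜ + (∫⁻ ω in A ∩ {ω | v ≤ f ω}, ENNReal.ofReal (f ω) ∂μ +
        ∫⁻ ω in A \ {ω | v ≤ f ω}, ENNReal.ofReal (f ω) ∂μ) := by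
        rw [mul_add, add_assoc]
        gcongr
    _ = _ := by rw [lintegral_inter_add_sdiff _ _ hB]

/-- A maximal inequality for functions whose drift is at most `K`. -/
theorem mul_noise_compl_staysBelow_le (hp₀ : 0 < p) (hp₁ : p < 1) (hqp : 0 < qp) (hqm : qm < 1)
    (hT₀ : 0 < T₀) {V : ℝ → ℝ} (hV : Measurable V) (hV₀ : ∀ T > 0, 0 ≤ V T) {K : ℝ}
    (hK : 0 ≤ K)
    (hdrift : ∀ T > 0, successRate p T * V (T * (1 + qp)) +
      (1 - successRate p T) * V (T * (1 - qm)) ≤ V T + K) (v : ℝ) (t n : ℕ) :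
    ENNReal.ofReal v * noise (staysBelow p qp qm T₀ V v t (n + 1))ᶜ ≤
      ∫⁻ U, ENNReal.ofReal (V (window p qp qm T₀ U t)) ∂noise + n * ENNReal.ofReal K := by
  have hf (n : ℕ) : Measurable fun U => V (window p qp qm T₀ U n) :=
    hV.comp (measurable_window p qp qm T₀ n)
  -- The surviving integral is kept to make the induction work: it is what the drift acts on at the
  -- next step.
  suffices ENNReal.ofReal v * noise (staysBelow p qp qm T₀ V v t (n + 1))ᶜ +
      ∫⁻ U in staysBelow p qp qm T₀ V v t (n + 1),
        ENNReal.ofReal (V (window p qp qm T₀ U (t + n))) ∂noise ≤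
      ∫⁻ U, ENNReal.ofReal (V (window p qp qm T₀ U t)) ∂noise + n * ENNReal.ofReal K from
    le_self_add.trans this
  induction n with
  | zero =>
    rw [staysBelow_succ]
    refine (mul_measure_compl_diff_add_le (hf _) v _).trans ?_
    simp [staysBelow]
  | succ n ih =>
    rw [staysBelow_succ]
    refine (mul_measure_compl_diff_add_le (hf _) v _).trans ?_
    have hinv (U : ℕ → unitInterval) (u : unitInterval) :
        Function.update U (t + n) u ∈ staysBelow p qp qm T₀ V v t (n + 1) ↔
          U ∈ staysBelow p qp qm T₀ V v t (n + 1) := by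
      refine forall₂_congr fun j hj => ?_
      rw [window_update (by omega)]
    have h := setLIntegral_window_succ_le hp₀ hp₁ hqp hqm hT₀ hV hV₀ zero_le_one hK
      (by simpa using hdrift) (measurableSet_staysBelow hV v t (n + 1)) hinv
    rw [ENNReal.ofReal_one, one_mul] at h
    refine (add_le_add_right h _).trans ?_
    rw [← add_assoc]
    refine (add_le_add_left ih _).trans (le_of_eq ?_)
    push_cast
    ring

end Dynamics

/-! ### Convergence and uniqueness of the limit. -/

theorem convergesAndStaysNear_ratioWindow {p c κ : ℝ} (hp₀ : 0 < p) (hp₁ : p < 1) (hc : 0 < c)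
    (hκ : 0 ≤ κ) : ConvergesAndStaysNear p c κ (ratioWindow p c) := by
  intro ε hε δ hδ
  have hL := ratioWindow_pos hp₀ hp₁ hc
  have hm : 0 < min 1 (Real.log (c + 1)) := lt_min one_pos (Real.log_pos (by linarith))
  obtain ⟨m, hm_def⟩ : ∃ m, m = min 1 (Real.log (c + 1)) := ⟨_, rfl⟩
  obtain ⟨C, hC_def⟩ : ∃ C, C = 2 * (c ^ 2 + 2) := ⟨_, rfl⟩
  obtain ⟨v, hv_def⟩ : ∃ v, v = ε ^ 2 / (ratioWindow p c * (ratioWindow p c + ε)) := ⟨_, rfl⟩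
  rw [← hm_def] at hm
  have hC : 0 < C := by rw [hC_def]; positivity
  have hv : 0 < v := by rw [hv_def]; positivity
  have hm₁ : m ≤ 1 := hm_def ▸ min_le_left _ _
  have hD : 0 < 2 * C / m + κ * C := by positivity
  -- The first two bounds are those of the drift estimate; the third makes the stationary error `2 C
  -- q / m` plus the accumulated error `κ C q` at most `δ v / 2`. The other half of `δ v` pays for
  -- the initial window.
  refine ⟨min (1 / 2) (min (m / C) (δ * v / 2 / (2 * C / m + κ * C))), by positivity, ?_⟩
  intro qp q hqp _ hq hq_lt hratio T₀ hT₀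
  obtain ⟨hq₁, hq₂, hq₃⟩ : q < 1 / 2 ∧ q < m / C ∧ q < δ * v / 2 / (2 * C / m + κ * C) := by
    simpa only [lt_min_iff] using hq_lt
  rw [lt_div_iff₀ hC] at hq₂
  rw [lt_div_iff₀ hD] at hq₃
  obtain rfl : qp = c * q := by rw [← hratio, div_mul_cancel₀ _ hq.ne']
  have hV := measurable_lyapunov (ratioWindow p c)
  have hV₀ : ∀ T > 0, 0 ≤ lyapunov (ratioWindow p c) T := fun T hT => lyapunov_nonneg hL hT
  have hdrift : ∀ T > 0, successRate p T * lyapunov (ratioWindow p c) (T * (1 + c * q)) +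
      (1 - successRate p T) * lyapunov (ratioWindow p c) (T * (1 - q)) ≤
      (1 - m / 2 * q) * lyapunov (ratioWindow p c) T + C * q ^ 2 := by
    intro T hT
    rw [hm_def, hC_def]
    exact expected_lyapunov_le hp₀ hp₁ hc hq hq₁.le (by rw [← hm_def, ← hC_def]; linarith) hT
  have hmq : 0 < m / 2 * q := by positivity
  have hρ : 0 ≤ 1 - m / 2 * q := by nlinarith
  have hK : 0 ≤ C * q ^ 2 := by positivity
  -- The `+ 1` avoids division by zero when `T₀` is already the limit.
  obtain ⟨t₀, ht₀⟩ := exists_pow_lt_of_lt_one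
    (show 0 < δ * v / 2 / (lyapunov (ratioWindow p c) T₀ + 1) from
      div_pos (by positivity) (by linarith [hV₀ _ hT₀]))
    (show 1 - m / 2 * q < 1 by linarith)
  rw [lt_div_iff₀ (by linarith [hV₀ _ hT₀])] at ht₀
  refine ⟨t₀, fun t ht => ?_⟩
  have hpow : (1 - m / 2 * q) ^ t * lyapunov (ratioWindow p c) T₀ ≤ δ * v / 2 := by
    have h₁ : (1 - m / 2 * q) ^ t ≤ (1 - m / 2 * q) ^ t₀ :=
      pow_le_pow_of_le_one hρ (by linarith) ht
    have h₂ := mul_le_mul_of_nonneg_right h₁ (hV₀ _ hT₀)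
    linarith [pow_nonneg hρ t₀]
  have hmax := mul_noise_compl_staysBelow_le hp₀ hp₁ hqp (by linarith : q < 1) hT₀ hV hV₀ hK
    (fun T hT => (hdrift T hT).trans
      (by linarith [mul_nonneg hmq.le (hV₀ T hT)])) v t ⌊κ / q⌋₊
  have hmean := lintegral_window_le hp₀ hp₁ hqp (by linarith : q < 1) hT₀ hV hV₀ hρ
    (by linarith) hK hdrift t
  have hN : (⌊κ / q⌋₊ : ℝ) * (C * q ^ 2) ≤ κ * C * q := by
    have := Nat.floor_le (div_nonneg hκ hq.le)
    calc (⌊κ / q⌋₊ : ℝ) * (C * q ^ 2) ≤ κ / q * (C * q ^ 2) := by gcongr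
      _ = κ * C * q := by field_simp
  have hgeom : C * q ^ 2 / (1 - (1 - m / 2 * q)) = 2 * C / m * q := by
    rw [sub_sub_cancel]
    field_simp
  -- `staysBelow` uses a strict bound on `j`, so `+ 1` includes the last step of the horizon.
  have hreal : v * noise.real (staysBelow p (c * q) q T₀ (lyapunov (ratioWindow p c)) v t
      (⌊κ / q⌋₊ + 1))ᶜ ≤ v * δ := by
    rw [← ENNReal.ofReal_le_ofReal_iff (by positivity), ENNReal.ofReal_mul hv.le,
      ofReal_measureReal]
    refine hmax.trans ((add_le_add_left hmean _).trans ?_)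
    rw [← ENNReal.ofReal_natCast, ← ENNReal.ofReal_mul (Nat.cast_nonneg _),
      ← ENNReal.ofReal_add (add_nonneg (mul_nonneg (pow_nonneg hρ t) (hV₀ _ hT₀))
        (div_nonneg hK (by linarith))) (by positivity)]
    refine ENNReal.ofReal_le_ofReal ?_
    rw [hgeom]
    linarith
  have hle := le_of_mul_le_mul_left hreal hv
  rw [probReal_compl_eq_one_sub (measurableSet_staysBelow hV _ _ _)] at hle
  refine (show 1 - δ ≤ noise.real (staysBelow p (c * q) q T₀ (lyapunov (ratioWindow p c)) v t
      (⌊κ / q⌋₊ + 1)) by linarith).trans (measureReal_mono fun U hU s hts hs => ?_)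
  obtain ⟨j, rfl⟩ := Nat.exists_eq_add_of_le hts
  have hj : j ≤ ⌊κ / q⌋₊ := by
    refine Nat.le_floor ?_
    push_cast at hs
    linarith
  have hlt := hU j (by omega)
  rw [hv_def] at hlt
  exact abs_sub_lt_of_lyapunov_lt hL (window_pos hqp (by linarith) hT₀ U _) hε hlt

/-- The window concentrates at one point at most. -/
theorem ConvergesAndStaysNear.unique {p c κ L L' : ℝ} (hc : 0 < c) (hκ : 0 ≤ κ)
    (h : ConvergesAndStaysNear p c κ L) (h' : ConvergesAndStaysNear p c κ L') : L = L' := by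
  by_contra hne
  have hd : 0 < |L - L'| / 2 := half_pos (abs_pos.2 (sub_ne_zero.2 hne))
  obtain ⟨q₁, hq₁, h⟩ := h _ hd (1 / 3) (by norm_num)
  obtain ⟨q₂, hq₂, h'⟩ := h' _ hd (1 / 3) (by norm_num)
  -- Dividing by `c` puts `c * q` below both thresholds too. At a common late step, two disjoint
  -- events would then each have probability at least `2 / 3`.
  obtain ⟨q, hq, hlt⟩ := exists_between
    (show 0 < min (min q₁ q₂) (min q₁ q₂ / c) from by positivity)
  simp only [lt_min_iff, lt_div_iff₀ hc, mul_comm q c] at hlt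
  obtain ⟨⟨ha₁, ha₂⟩, hb⟩ := hlt
  have hcq : 0 < c * q := mul_pos hc hq
  obtain ⟨t₁, ht₁⟩ := h (c * q) q hcq hb.1 hq ha₁
    (mul_div_cancel_right₀ c hq.ne') 1 one_pos
  obtain ⟨t₂, ht₂⟩ := h' (c * q) q hcq hb.2 hq ha₂
    (mul_div_cancel_right₀ c hq.ne') 1 one_pos
  have e₁ := ht₁ (max t₁ t₂) (le_max_left _ _)
  have e₂ := ht₂ (max t₁ t₂) (le_max_right _ _)
  obtain ⟨n, hn⟩ : ∃ n, n = max t₁ t₂ := ⟨_, rfl⟩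
  rw [← hn] at e₁ e₂
  have hs : (n : ℝ) ≤ n + κ / q := by linarith [div_nonneg hκ hq.le]
  have hm (x : ℝ) : MeasurableSet {U | |window p (c * q) q 1 U n - x| < |L - L'| / 2} :=
    measurableSet_lt ((measurable_window p (c * q) q 1 n).sub_const x).abs measurable_const
  have f₁ := e₁.trans (measureReal_mono (μ := noise)
    (show _ ⊆ {U | |window p (c * q) q 1 U n - L| < |L - L'| / 2} from
      fun U hU => hU n le_rfl hs))
  have f₂ := e₂.trans (measureReal_mono (μ := noise)
    (show _ ⊆ {U | |window p (c * q) q 1 U n - L'| < |L - L'| / 2} from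
      fun U hU => hU n le_rfl hs))
  have hdisj : Disjoint {U | |window p (c * q) q 1 U n - L| < |L - L'| / 2}
      {U | |window p (c * q) q 1 U n - L'| < |L - L'| / 2} := by
    rw [Set.disjoint_left]
    intro U h₁ h₂
    have h₃ := abs_sub_le L (window p (c * q) q 1 U n) L'
    rw [abs_sub_comm L (window p (c * q) q 1 U n)] at h₃
    have h₁' : |window p (c * q) q 1 U n - L| < |L - L'| / 2 := h₁
    have h₂' : |window p (c * q) q 1 U n - L'| < |L - L'| / 2 := h₂
    linarith
  have hu := measureReal_union (μ := noise) hdisj (hm L')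
  have hle : noise.real ({U | |window p (c * q) q 1 U n - L| < |L - L'| / 2} ∪
      {U | |window p (c * q) q 1 U n - L'| < |L - L'| / 2}) ≤ 1 := measureReal_le_one
  linarith

theorem ratioWindow_injOn {p c c' : ℝ} (hp₀ : 0 < p) (hp₁ : p < 1) (hc : 0 < c) (hc' : 0 < c')
    (h : ratioWindow p c = ratioWindow p c') : c = c' := by
  have h₁ := (successRate_eq_inv_iff hp₀ hp₁ hc).2 rfl
  rw [h, (successRate_eq_inv_iff hp₀ hp₁ hc').2 rfl, one_div, one_div, inv_inj] at h₁
  linarith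

end SpeedUp

theorem theorem6 (p : ℝ) (hp₀ : 0 < p) (hp₁ : p < 1) :
    -- the mean window: it exists, is unique, and is characterized by its success rate
    (∀ qp qm : ℝ, 0 < qp → 0 < qm →
      (∃! T : ℝ, SpeedUp.IsMeanWindow p qp qm T) ∧
      ∀ T : ℝ, 0 < T →
        (SpeedUp.IsMeanWindow p qp qm T ↔ SpeedUp.successRate p T = qm / (qp + qm))) ∧
    -- it depends only on the ratio of the two parameters, and the window concentrates at it
    (∀ c : ℝ, 0 < c → ∃ T : ℝ,
      (∀ qp qm : ℝ, 0 < qp → 0 < qm → qp / qm = c → SpeedUp.IsMeanWindow p qp qm T) ∧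
      ∀ κ : ℝ, 0 ≤ κ → SpeedUp.ConvergesAndStaysNear p c κ T) ∧
    -- there is exactly one optimal window, and the window concentrates at it iff the ratio is e - 1
    (∃! T : ℝ, SpeedUp.IsOptimalWindow p T) ∧
    ∀ T : ℝ, SpeedUp.IsOptimalWindow p T → ∀ c : ℝ, 0 < c → ∀ κ : ℝ, 0 ≤ κ →
      (SpeedUp.ConvergesAndStaysNear p c κ T ↔ c = Real.exp 1 - 1) := by
  have he : 0 < Real.exp 1 - 1 := by linarith [Real.add_one_lt_exp one_ne_zero]
  refine ⟨fun qp qm hqp hqm => ⟨?_, fun T hT => SpeedUp.isMeanWindow_iff hqp hqm hT⟩,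
    fun c hc => ⟨SpeedUp.ratioWindow p c, fun qp qm hqp hqm h =>
      (SpeedUp.isMeanWindow_iff_eq hp₀ hp₁ hqp hqm h).2 rfl,
      fun κ hκ => SpeedUp.convergesAndStaysNear_ratioWindow hp₀ hp₁ hc hκ⟩, ?_, ?_⟩
  · simp only [SpeedUp.isMeanWindow_iff_eq hp₀ hp₁ hqp hqm rfl, existsUnique_eq]
  · simp only [SpeedUp.isOptimalWindow_iff hp₀ hp₁, existsUnique_eq]
  · intro T hT c hc κ hκ
    rw [SpeedUp.isOptimalWindow_iff hp₀ hp₁] at hT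
    subst hT
    constructor
    · intro h
      exact SpeedUp.ratioWindow_injOn hp₀ hp₁ hc he
        ((SpeedUp.convergesAndStaysNear_ratioWindow hp₀ hp₁ hc hκ).unique hc hκ h)
    · rintro rfl
      exact SpeedUp.convergesAndStaysNear_ratioWindow hp₀ hp₁ hc hκ
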